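/- All spaces are metrizable. For a continuous map $f\colon X\to X$ and $x\in X$ put $\alpha_f(x)=\bigcap_{n\ge 0}\overline{\bigcup_{k\ge n} f^{-k}(x)}$. A space $X$ has the $\mathcal{AF}$-property if the sets $\alpha_f(x)$, over all continuous $f\colon X\to X$ and all $x\in X$, are exactly the closed subsets of $X$. A space has enough arcs if it has at least two points and for every nonempty proper closed subset $A$ there is an arc in the space (a homeomorphic copy of $[0,1]$) with one endpoint in $A$ and the other one outside $A$. Let $S=\{\langle x,\sin\frac1x\rangle : 0<x\le \frac2\pi\}\subseteq\mathbb R^2$ and let $\overline S$ be its closure, the closed topologist's sine curve; its convergence continuum is the arc $\{0\}\times[-1,1]$, and the endpoint of $S$ is $\langle \frac2\pi,1\rangle$. The extended sine curve is the subspace $X=\overline S\cup\{\langle x,-1\rangle : -1\le x\le 0\}$ of $\mathbb R^2$. A chain of sine curves is a metrizable space $Y=\{s_\infty\}\cup\bigcup_{i\ge1}\overline S_i$, where each $\overline S_i$ is a homeomorphic copy of $\overline S$, with $S_i$ and $[a_i,b_i]$ corresponding to $S$ and to the convergence continuum, and where: $s_\infty\notin\overline S_i$ for all $i$; every neighbourhood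 of $s_\infty$ contains all but finitely many of the sets $\overline S_i$; $\overline S_i\cap\overline S_{i+1}=\{b_i\}$ and $\overline S_i\cap\overline S_j=\emptyset$ for $j>i+1$; and $b_i$ is one of the two endpoints of the arc $[a_i,b_i]$ and is the endpoint of $S_{i+1}$. Lemma. The extended sine curve has the $\mathcal{AF}$-property and does not have enough arcs. Every chain of sine curves has the $\mathcal{AF}$-property and does not have enough arcs. -/

import Mathlib

open Set Filter Topology

namespace AFSpaces

/-! ### Alpha-limit sets, the AF-property, enough arcs -/

/-- The `α`-limit set of `x` under `f : X → X`:
the intersection over `n ≥ 0` of the closures of `⋃_{k ≥ n} f^{-k}(x)`. -/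
def alphaLimitSet {X : Type*} [TopologicalSpace X] (f : X → X) (x : X) : Set X :=
  ⋂ n : ℕ, closure (⋃ k : ℕ, ⋃ _ : n ≤ k, f^[k] ⁻¹' {x})

/-- The family of `α`-limit sets in `X`, over all continuous self-maps and all points. -/
def alphaLimitSets (X : Type*) [TopologicalSpace X] : Set (Set X) :=
  {A | ∃ (f : X → X) (x : X), Continuous f ∧ A = alphaLimitSet f x}

/-- `X` has the AF-property: the `α`-limit sets in `X` are exactly the closed sets in `X`. -/
def HasAFProperty (X : Type*) [TopologicalSpace X] : Prop :=
  alphaLimitSets X = {A : Set X | IsClosed A}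

/-- `X` contains an arc (a homeomorphic copy of `[0,1]`) with one endpoint in `A` and
the other one in the complement of `A`. -/
def JoinedToComplByArc {X : Type*} [TopologicalSpace X] (A : Set X) : Prop :=
  ∃ γ : unitInterval → X, IsEmbedding γ ∧ γ 0 ∈ A ∧ γ 1 ∉ A

/-- A (metrizable) space has enough arcs if it is nondegenerate and every nonempty proper closed
subset is joined to its complement by an arc. -/
def HasEnoughArcs (X : Type*) [TopologicalSpace X] : Prop :=
  Nontrivial X ∧
    ∀ A : Set X, IsClosed A → A.Nonempty → A ≠ univ → JoinedToComplByArc A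

/-! ### Sine curves -/

/-- The sine curve `S = {(x, sin (1/x)) : 0 < x ≤ 2/π}` in the plane. -/
def openSineCurve : Set (ℝ × ℝ) :=
  {p | 0 < p.1 ∧ p.1 ≤ 2 / Real.pi ∧ p.2 = Real.sin (1 / p.1)}

/-- The closed topologist's sine curve, the closure of `S` in the plane. -/
def closedSineCurve : Set (ℝ × ℝ) := closure openSineCurve

/-- The extended sine curve: the closed sine curve together with the segment from
`b = (0,-1)` to `c = (-1,-1)`. -/
def extendedSineCurve : Set (ℝ × ℝ) :=
  closedSineCurve ∪ {p | -1 ≤ p.1 ∧ p.1 ≤ 0 ∧ p.2 = -1}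

theorem mem_closedSineCurve_of_sin_eq (t y : ℝ) (ht : Real.pi / 2 ≤ t) (hy : Real.sin t = y) :
    ((0 : ℝ), y) ∈ closedSineCurve := by
  have hpi := Real.pi_pos
  have hu : Tendsto (fun n : ℕ => t + n * (2 * Real.pi)) atTop atTop :=
    tendsto_atTop_add_const_left _ _
      (tendsto_natCast_atTop_atTop.atTop_mul_const (by positivity))
  have hlim : Tendsto (fun n : ℕ => ((t + n * (2 * Real.pi))⁻¹, y)) atTop (𝓝 ((0 : ℝ), y)) :=
    (tendsto_inv_atTop_zero.comp hu).prodMk_nhds tendsto_const_nhds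
  refine mem_closure_of_tendsto hlim (Eventually.of_forall fun n => ?_)
  have hn : Real.pi / 2 ≤ t + n * (2 * Real.pi) := by
    have : (0 : ℝ) ≤ n * (2 * Real.pi) := by positivity
    linarith
  refine ⟨inv_pos.2 (by linarith), ?_, ?_⟩
  · have h := inv_anti₀ (by positivity) hn
    rwa [inv_div] at h
  · simp only [one_div, inv_inv, Real.sin_add_nat_mul_two_pi]
    exact hy.symm

/-- The endpoint `a = (0,1)` of the convergence continuum `{0} × [-1,1]`. -/
def topPoint : closedSineCurve :=
  ⟨(0, 1), mem_closedSineCurve_of_sin_eq (Real.pi / 2) 1 le_rfl Real.sin_pi_div_two⟩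

/-- The endpoint `b = (0,-1)` of the convergence continuum `{0} × [-1,1]`. -/
def bottomPoint : closedSineCurve :=
  ⟨(0, -1), mem_closedSineCurve_of_sin_eq (Real.pi / 2 + Real.pi) (-1)
    (by linarith [Real.pi_pos]) (by rw [Real.sin_add_pi, Real.sin_pi_div_two])⟩

/-- The unique endpoint `(2/π, 1)` of the sine curve `S`. -/
noncomputable def endPoint : closedSineCurve :=
  ⟨(2 / Real.pi, 1), subset_closure
    ⟨by positivity, le_rfl, by rw [one_div_div, Real.sin_pi_div_two]⟩⟩

/-- The data exhibiting a space `Y` as a chain of sine curves. The `i`-th closed sine curve is the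
range of `curve i`, a copy in `Y` of the closed topologist's sine curve; its open sine curve and
its convergence continuum are the images of `S` and of `{0} × [-1,1]`. -/
structure ChainOfSineCurves (Y : Type*) [TopologicalSpace Y] where
  /-- parametrizations of the closed sine curves in `Y` -/
  curve : ℕ → closedSineCurve → Y
  /-- the points common to consecutive curves -/
  b : ℕ → Y
  /-- the limit point -/
  s : Y
  isEmbedding_curve : ∀ i, IsEmbedding (curve i)
  /-- `b i` is one of the two endpoints of the convergence continuum of the `i`-th curve -/
  b_eq : ∀ i, b i = curve i topPoint ∨ b i = curve i bottomPoint
  /-- `b i` is the endpoint of the `(i+1)`-st open sine curve -/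
  b_eq_endPoint : ∀ i, b i = curve (i + 1) endPoint
  inter_succ : ∀ i, range (curve i) ∩ range (curve (i + 1)) = {b i}
  disjoint_of_lt : ∀ i j, i + 1 < j → Disjoint (range (curve i)) (range (curve j))
  s_notMem : ∀ i, s ∉ range (curve i)
  union_eq : (⋃ i, range (curve i)) ∪ {s} = univ
  /-- the curves converge to the point `s` -/
  converges : ∀ U ∈ 𝓝 s, ∀ᶠ i in atTop, range (curve i) ⊆ U

end AFSpaces

/-! If some path leaves the closed set `A`, let `t₀` be its last time in `A` and send `z` to the
path at time `t₀` plus the distance from `z` to `A`. This collapses `A` to one of its points and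
keeps the complement outside `A`, so `A` is an `α`-limit set (`mem_alphaLimitSets_of_joined`).

The other nonempty proper closed sets are unions of path components. In the spaces at hand they are
`r ⁻¹' convergenceContinuum` for retractions `r` onto a closed sine curve or, in a chain, `{s}`, for
which the identity works. For the former, follow `r` by the map `(x, sin (1/x)) ↦ (x/5, sin (5/x))`.
It extends to the limit arc as angle multiplication by five, so iterated preimages of the attaching
point are dense there and never leave it (`preimage_convergenceContinuum_mem_alphaLimitSets`).

The same retractions refute enough arcs: an arc leaving such a preimage would give a path from the
limit arc into the open sine curve. -/

namespace AFSpaces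

/-! ### Sufficient conditions for being an `α`-limit set -/

section General

variable {X : Type*} [TopologicalSpace X]

theorem isClosed_alphaLimitSet (f : X → X) (x : X) : IsClosed (alphaLimitSet f x) :=
  isClosed_iInter fun _ => isClosed_closure

/-- Constant maps settle the extreme cases: the value has everything as preimage, any other point
nothing. -/
theorem hasAFProperty_of_forall
    (h : ∀ A : Set X, IsClosed A → A.Nonempty → A ≠ univ → A ∈ alphaLimitSets X)
    [Nontrivial X] : HasAFProperty X := by
  refine Subset.antisymm ?_ fun A hA => ?_
  · rintro _ ⟨f, x, -, rfl⟩
    exact isClosed_alphaLimitSet f x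
  obtain ⟨c, d, hcd⟩ := exists_pair_ne X
  rcases A.eq_empty_or_nonempty with rfl | hne
  · refine ⟨fun _ => c, d, continuous_const, (subset_empty_iff.1 ?_).symm⟩
    intro z hz
    have h1 := mem_iInter.1 hz 1
    have h2 : (⋃ k : ℕ, ⋃ _ : 1 ≤ k, (fun _ : X => c)^[k] ⁻¹' {d}) = ∅ := by
      simp only [iUnion_eq_empty]
      intro k hk
      obtain ⟨m, rfl⟩ := Nat.exists_eq_add_of_le' hk
      ext w
      rw [mem_preimage, Function.iterate_succ_apply']
      exact iff_of_false hcd (notMem_empty w)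
    rw [h2, closure_empty] at h1
    exact h1
  by_cases hu : A = univ
  · subst hu
    refine ⟨fun _ => c, c, continuous_const, (eq_univ_of_forall fun z => ?_).symm⟩
    refine mem_iInter.2 fun n => subset_closure (mem_iUnion₂.2 ⟨n + 1, n.le_succ, ?_⟩)
    rw [mem_preimage, Function.iterate_succ_apply']
    rfl
  · exact h A hA hne hu

theorem mem_alphaLimitSets_of_preimage_eq {f : X → X} {x : X} {A : Set X} (hf : Continuous f)
    (hA : IsClosed A) (h1 : f ⁻¹' {x} = A) (h2 : f ⁻¹' A = A) : A ∈ alphaLimitSets X := by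
  have key : ∀ k : ℕ, f^[k + 1] ⁻¹' {x} = A := by
    intro k
    induction k with
    | zero => simpa using h1
    | succ k ih => rw [Function.iterate_succ, preimage_comp, ih, h2]
  refine ⟨f, x, hf, Subset.antisymm (fun z hz => ?_) fun z hz => ?_⟩
  · refine mem_iInter.2 fun n => subset_closure (mem_iUnion₂.2 ⟨n + 1, n.le_succ, ?_⟩)
    rwa [key]
  · refine closure_minimal (iUnion₂_subset fun k hk => ?_) hA (mem_iInter.1 hz 1)
    obtain ⟨m, rfl⟩ := Nat.exists_eq_add_of_le' hk
    exact (key m).subset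

theorem singleton_mem_alphaLimitSets [T1Space X] (x : X) : {x} ∈ alphaLimitSets X :=
  mem_alphaLimitSets_of_preimage_eq continuous_id isClosed_singleton rfl rfl

/-- A closed set whose complement can be reached from it by a path is an `α`-limit set. -/
theorem mem_alphaLimitSets_of_joined [TopologicalSpace.MetrizableSpace X] {A : Set X}
    (hA : IsClosed A) {x y : X} (hx : x ∈ A) (hy : y ∉ A) (h : Joined x y) :
    A ∈ alphaLimitSets X := by
  let := TopologicalSpace.metrizableSpaceMetric X
  obtain ⟨γ⟩ := h
  -- `t₀` is the last time at which the path is in `A`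
  obtain ⟨t₀, ht₀, hmax⟩ := (hA.preimage γ.continuous).isCompact.exists_isGreatest
    ⟨0, by simpa using hx⟩
  have ht₀1 : (t₀ : ℝ) < 1 := by
    refine lt_of_le_of_ne t₀.2.2 fun h => hy ?_
    have : t₀ = 1 := Subtype.ext h
    rw [this] at ht₀
    simpa using ht₀
  -- Beyond time 1 the extended path rests at `y`, so unbounded distances to `A` do no harm.
  have hlt : ∀ s : ℝ, t₀ < s → γ.extend s ∉ A := by
    intro s hs hsA
    have h3 := hmax (show projIcc (0 : ℝ) 1 zero_le_one s ∈ γ ⁻¹' A from hsA)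
    have h4 : (projIcc (0 : ℝ) 1 zero_le_one s : ℝ) ≤ t₀ := h3
    rw [coe_projIcc] at h4
    have h5 := t₀.2.1
    rcases le_total s 1 with h | h
    · rw [min_eq_right h] at h4
      exact absurd ((le_max_right _ _).trans h4) (not_le.2 hs)
    · rw [min_eq_left h] at h4
      exact absurd ((le_max_right _ _).trans h4) (not_le.2 ht₀1)
  have h0 : γ.extend t₀ ∈ A := by
    rw [Path.extend_apply γ t₀.2]
    exact ht₀
  set f : X → X := fun z => γ.extend (t₀ + Metric.infDist z A) with hf
  have hin : ∀ z ∈ A, f z = γ.extend t₀ := fun z hz => by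
    simp [hf, Metric.infDist_zero_of_mem hz]
  have hout : ∀ z, z ∉ A → f z ∉ A := fun z hz =>
    hlt _ (by linarith [(hA.notMem_iff_infDist_pos ⟨x, hx⟩).1 hz])
  have hfc : Continuous f :=
    γ.continuous_extend.comp (continuous_const.add (Metric.continuous_infDist_pt A))
  refine mem_alphaLimitSets_of_preimage_eq (f := f) (x := γ.extend t₀) hfc hA ?_ ?_
  · ext z
    refine ⟨fun hz => ?_, fun hz => hin z hz⟩
    by_contra hzA
    exact hout z hzA (by rw [show f z = _ from hz]; exact h0)
  · ext z
    refine ⟨fun hz => ?_, fun hz => ?_⟩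
    · by_contra hzA
      exact hout z hzA hz
    · rw [mem_preimage, hin z hz]
      exact h0

end General

/-! ### The closed sine curve: path components and the quintupling map -/

section ClosedSineCurve

open Real

theorem closedSineCurve_subset {p : ℝ × ℝ} (hp : p ∈ closedSineCurve) :
    0 ≤ p.1 ∧ p.1 ≤ 2 / π ∧ -1 ≤ p.2 ∧ p.2 ≤ 1 ∧ (0 < p.1 → p.2 = sin (1 / p.1)) := by
  obtain ⟨u, hu, hlim⟩ := mem_closure_iff_seq_limit.1 hp
  have h1 := (continuous_fst.tendsto p).comp hlim
  have h2 := (continuous_snd.tendsto p).comp hlim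
  refine ⟨ge_of_tendsto' h1 fun n => (hu n).1.le, le_of_tendsto' h1 fun n => (hu n).2.1,
    ge_of_tendsto' h2 fun n => ?_, le_of_tendsto' h2 fun n => ?_, fun hpos => ?_⟩
  · simp only [Function.comp_apply, (hu n).2.2, neg_one_le_sin]
  · simp only [Function.comp_apply, (hu n).2.2, sin_le_one]
  · have h3 : Tendsto (fun n => sin (1 / (u n).1)) atTop (𝓝 (sin (1 / p.1))) :=
      (continuous_sin.tendsto _).comp (tendsto_const_nhds.div h1 hpos.ne')
    refine tendsto_nhds_unique h2 (h3.congr fun n => ?_)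
    simp only [Function.comp_apply, (hu n).2.2]

theorem zero_mem_closedSineCurve {y : ℝ} (h1 : -1 ≤ y) (h2 : y ≤ 1) :
    ((0 : ℝ), y) ∈ closedSineCurve := by
  refine mem_closedSineCurve_of_sin_eq (arcsin y + 2 * π) y ?_ ?_
  · linarith [neg_pi_div_two_le_arcsin y, pi_pos]
  · rw [sin_add_two_pi, sin_arcsin h1 h2]

theorem graph_mem_closedSineCurve {x : ℝ} (h1 : 0 < x) (h2 : x ≤ 2 / π) :
    (x, sin (1 / x)) ∈ closedSineCurve :=
  subset_closure ⟨h1, h2, rfl⟩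

/-- The convergence continuum `{0} × [-1,1]`. -/
def convergenceContinuum : Set closedSineCurve := {p | p.1.1 = 0}

theorem isClosed_convergenceContinuum : IsClosed convergenceContinuum :=
  isClosed_eq (continuous_fst.comp continuous_subtype_val) continuous_const

theorem topPoint_mem : topPoint ∈ convergenceContinuum := rfl

theorem bottomPoint_mem : bottomPoint ∈ convergenceContinuum := rfl

theorem endPoint_notMem : endPoint ∉ convergenceContinuum := by
  change ¬ (2 / π = 0)
  positivity

theorem pos_of_notMem {p : closedSineCurve} (hp : p ∉ convergenceContinuum) : 0 < p.1.1 :=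
  lt_of_le_of_ne (closedSineCurve_subset p.2).1 (Ne.symm hp)

theorem joined_endPoint {p : closedSineCurve} (hp : p ∉ convergenceContinuum) :
    Joined p endPoint := by
  have hpos := pos_of_notMem hp
  obtain ⟨-, hle, -, -, hsin⟩ := closedSineCurve_subset p.2
  let g : Ioc (0 : ℝ) (2 / π) → closedSineCurve := fun x =>
    ⟨(x, sin (1 / x)), graph_mem_closedSineCurve x.2.1 x.2.2⟩
  have hg : Continuous g := by
    refine Continuous.subtype_mk (continuous_subtype_val.prodMk
      (continuous_sin.comp (continuous_const.div continuous_subtype_val fun x => x.2.1.ne'))) _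
  have hpc : PathConnectedSpace (Ioc (0 : ℝ) (2 / π)) :=
    isPathConnected_iff_pathConnectedSpace.1
      ((convex_Ioc _ _).isPathConnected ⟨2 / π, by positivity, le_rfl⟩)
  have h := (hpc.joined ⟨p.1.1, hpos, hle⟩ ⟨2 / π, by positivity, le_rfl⟩).map hg
  convert h using 1
  · exact Subtype.ext (Prod.ext rfl (hsin hpos))
  · exact Subtype.ext (Prod.ext rfl (by simp [endPoint, g]))

theorem joined_of_mem_convergenceContinuum {p q : closedSineCurve}
    (hp : p ∈ convergenceContinuum) (hq : q ∈ convergenceContinuum) : Joined p q := by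
  let g : Icc (-1 : ℝ) 1 → closedSineCurve := fun y =>
    ⟨(0, y), zero_mem_closedSineCurve y.2.1 y.2.2⟩
  have hg : Continuous g :=
    Continuous.subtype_mk (continuous_const.prodMk continuous_subtype_val) _
  have hpc : PathConnectedSpace (Icc (-1 : ℝ) 1) :=
    isPathConnected_iff_pathConnectedSpace.1
      ((convex_Icc _ _).isPathConnected ⟨0, by norm_num, by norm_num⟩)
  obtain ⟨-, -, h1, h2, -⟩ := closedSineCurve_subset p.2
  obtain ⟨-, -, h3, h4, -⟩ := closedSineCurve_subset q.2
  have h := (hpc.joined ⟨p.1.2, h1, h2⟩ ⟨q.1.2, h3, h4⟩).map hg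
  convert h using 1
  · exact Subtype.ext (Prod.ext hp rfl)
  · exact Subtype.ext (Prod.ext hq rfl)

theorem dense_compl_convergenceContinuum : Dense convergenceContinuumᶜ := by
  intro p
  rw [closure_subtype]
  refine closure_mono ?_ p.2
  intro q hq
  exact ⟨⟨q, subset_closure hq⟩, hq.1.ne', rfl⟩

/-- There is no path from the convergence continuum to the open sine curve: a real form. -/
theorem not_continuous_sine_path {g u : ℝ → ℝ} (hg : Continuous g) (hu : Continuous u)
    (hnn : ∀ t, 0 ≤ g t) (hgu : ∀ t, 0 < g t → u t = sin (1 / g t))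
    (h0 : g 0 = 0) (h1 : 0 < g 1) : False := by
  have hcpt : IsCompact (Icc (0 : ℝ) 1 ∩ g ⁻¹' {0}) :=
    isCompact_Icc.inter_right (isClosed_singleton.preimage hg)
  obtain ⟨t₀, ⟨⟨ht0, ht1⟩, hgt⟩, hmax⟩ := hcpt.exists_isGreatest ⟨0, ⟨le_rfl, zero_le_one⟩, h0⟩
  have hgt : g t₀ = 0 := hgt
  have hlt : t₀ < 1 := lt_of_le_of_ne ht1 fun h => by rw [← h, hgt] at h1; exact lt_irrefl _ h1
  obtain ⟨δ, hδ, hδu⟩ := Metric.continuous_iff.1 hu t₀ 1 one_pos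
  obtain ⟨t₁, ht₀₁, ht₁⟩ := exists_between (lt_min hlt (lt_add_of_pos_right t₀ hδ))
  have ht₁1 : t₁ < 1 := ht₁.trans_le (min_le_left _ _)
  have ht₁δ : t₁ < t₀ + δ := ht₁.trans_le (min_le_right _ _)
  have hpos : 0 < g t₁ := by
    refine lt_of_le_of_ne (hnn _) fun h => ?_
    exact absurd (hmax ⟨⟨ht0.trans ht₀₁.le, ht₁1.le⟩, h.symm⟩) (not_le.2 ht₀₁)
  -- Just after the last zero `t₀` of `g`, all small positive values are taken, so `u` runs through
  -- `sin θ` for all large `θ` while staying within 1 of `u t₀`. The values 1 and -1 then clash.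
  have key : ∀ θ : ℝ, 0 < θ → 1 / g t₁ ≤ θ → |sin θ - u t₀| < 1 := by
    intro θ hθ hle
    have hmem : 1 / θ ∈ Icc (g t₀) (g t₁) := by
      rw [hgt]
      exact ⟨by positivity, (one_div_le hpos hθ).1 hle⟩
    obtain ⟨t, ⟨hta, htb⟩, ht⟩ := intermediate_value_Icc ht₀₁.le hg.continuousOn hmem
    have hd := hδu t (by rw [Real.dist_eq, abs_of_nonneg (by linarith)]; linarith)
    rw [hgu t (by rw [ht]; positivity), ht, one_div_one_div, Real.dist_eq] at hd
    exact hd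
  obtain ⟨n, hn⟩ := exists_nat_ge (1 / g t₁)
  have hπ := pi_gt_three
  have hn0 : (0 : ℝ) ≤ n := n.cast_nonneg
  have hnπ : (n : ℝ) ≤ n * (2 * π) := by nlinarith
  have ha := key (π / 2 + n * (2 * π)) (by linarith) (by linarith)
  have hb := key (π / 2 + π + n * (2 * π)) (by linarith) (by linarith)
  rw [sin_add_nat_mul_two_pi, sin_pi_div_two, abs_lt] at ha
  rw [sin_add_nat_mul_two_pi, sin_add_pi, sin_pi_div_two, abs_lt] at hb
  linarith [ha.1, ha.2, hb.1, hb.2]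

theorem mem_convergenceContinuum_of_joined {p q : closedSineCurve} (h : Joined p q)
    (hp : p ∈ convergenceContinuum) : q ∈ convergenceContinuum := by
  by_contra hq
  obtain ⟨γ⟩ := h
  have hc : Continuous fun t : ℝ => (γ.extend t).1 :=
    continuous_subtype_val.comp γ.continuous_extend
  refine not_continuous_sine_path (continuous_fst.comp hc) (continuous_snd.comp hc)
    (fun t => (closedSineCurve_subset (γ.extend t).2).1)
    (fun t => (closedSineCurve_subset (γ.extend t).2).2.2.2.2) ?_ ?_
  · simpa [convergenceContinuum] using hp
  · simpa using pos_of_notMem hq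

/-- As a polynomial in the sine, multiplication of the angle by five extends continuously over the
limit arc. -/
theorem sin_five_mul (t : ℝ) : sin (5 * t) = 5 * sin t - 20 * sin t ^ 3 + 16 * sin t ^ 5 := by
  rw [show 5 * t = 3 * t + 2 * t by ring, sin_add, sin_three_mul, cos_three_mul, sin_two_mul,
    cos_two_mul]
  have h : cos t ^ 2 = 1 - sin t ^ 2 := cos_sq' t
  have h4 : cos t ^ 4 = (1 - sin t ^ 2) ^ 2 := by rw [← h]; ring
  linear_combination (2 * (3 * sin t - 4 * sin t ^ 3) - 6 * sin t) * h + 8 * sin t * h4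

/-- The self-map of the closed sine curve that multiplies angles by five. -/
noncomputable def quintuple (p : closedSineCurve) : closedSineCurve :=
  ⟨(p.1.1 / 5, 5 * p.1.2 - 20 * p.1.2 ^ 3 + 16 * p.1.2 ^ 5), by
    have hm : MapsTo (fun q : ℝ × ℝ => (q.1 / 5, 5 * q.2 - 20 * q.2 ^ 3 + 16 * q.2 ^ 5))
        openSineCurve openSineCurve := by
      rintro ⟨x, y⟩ ⟨h1, h2, h3⟩
      dsimp only at h1 h2 h3
      refine ⟨by positivity, by dsimp only; linarith, ?_⟩
      dsimp only
      rw [h3, ← sin_five_mul]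
      congr 1
      field_simp
    exact hm.closure (by fun_prop) p.2⟩

theorem continuous_quintuple : Continuous quintuple := by
  unfold quintuple
  fun_prop

theorem quintuple_mem_iff {p : closedSineCurve} :
    quintuple p ∈ convergenceContinuum ↔ p ∈ convergenceContinuum := by
  change p.1.1 / 5 = 0 ↔ p.1.1 = 0
  simp

theorem quintuple_iterate_mem_iff {p : closedSineCurve} (k : ℕ) :
    quintuple^[k] p ∈ convergenceContinuum ↔ p ∈ convergenceContinuum := by
  induction k with
  | zero => rfl
  | succ k ih => rw [Function.iterate_succ_apply', quintuple_mem_iff, ih]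

/-- The point of the convergence continuum with a given angle. -/
noncomputable def anglePoint (θ : ℝ) : closedSineCurve :=
  ⟨(0, sin θ), zero_mem_closedSineCurve (neg_one_le_sin θ) (sin_le_one θ)⟩

theorem continuous_anglePoint : Continuous anglePoint := by
  unfold anglePoint
  fun_prop

theorem quintuple_iterate_anglePoint (k : ℕ) (θ : ℝ) :
    quintuple^[k] (anglePoint θ) = anglePoint (5 ^ k * θ) := by
  induction k with
  | zero => simp
  | succ k ih =>
    rw [Function.iterate_succ_apply', ih]
    refine Subtype.ext (Prod.ext (by simp [quintuple, anglePoint]) ?_)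
    change 5 * sin (5 ^ k * θ) - 20 * sin (5 ^ k * θ) ^ 3 + 16 * sin (5 ^ k * θ) ^ 5
      = sin (5 ^ (k + 1) * θ)
    rw [← sin_five_mul]
    congr 1
    ring

theorem exists_angle {p : closedSineCurve} (hp : p ∈ convergenceContinuum) :
    ∃ θ, p = anglePoint θ := by
  obtain ⟨-, -, h1, h2, -⟩ := closedSineCurve_subset p.2
  exact ⟨arcsin p.1.2, Subtype.ext (Prod.ext hp (sin_arcsin h1 h2).symm)⟩

/-- This is why the factor is five: it is 1 modulo 4, so the angles `±π/2` are fixed modulo `2π`.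
Tripling would swap the two endpoints. -/
theorem quintuple_eq_self {p : closedSineCurve} (hp : p = topPoint ∨ p = bottomPoint) :
    quintuple p = p := by
  rcases hp with rfl | rfl
  · refine Subtype.ext (Prod.ext ?_ ?_) <;> norm_num [quintuple, topPoint]
  · refine Subtype.ext (Prod.ext ?_ ?_) <;> norm_num [quintuple, bottomPoint]

/-- Every point of the convergence continuum is the limit of `k`-th preimages of every other. -/
theorem exists_tendsto_preimages {p q : closedSineCurve} (hp : p ∈ convergenceContinuum)
    (hq : q ∈ convergenceContinuum) :
    ∃ u : ℕ → closedSineCurve, (∀ k, quintuple^[k] (u k) = q) ∧ Tendsto u atTop (𝓝 p) := by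
  obtain ⟨θ, rfl⟩ := exists_angle hp
  obtain ⟨β, rfl⟩ := exists_angle hq
  -- The `k`-th preimages of the angle `β` include `(β + 2πj) / 5 ^ k`; this `j` brings one within
  -- `(|β| + 2π) / 5 ^ k` of `θ`.
  set j : ℕ → ℤ := fun k => ⌊5 ^ k * θ / (2 * π)⌋
  refine ⟨fun k => anglePoint ((β + j k * (2 * π)) / 5 ^ k), fun k => ?_, ?_⟩
  · rw [quintuple_iterate_anglePoint, mul_div_cancel₀ _ (by positivity)]
    exact Subtype.ext (Prod.ext rfl (sin_add_int_mul_two_pi β (j k)))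
  · refine (continuous_anglePoint.tendsto θ).comp ?_
    have h5 : Tendsto (fun k : ℕ => (|β| + 2 * π) * (1 / 5 : ℝ) ^ k) atTop (𝓝 0) := by
      simpa using (tendsto_pow_atTop_nhds_zero_of_lt_one (r := (1 / 5 : ℝ))
        (by norm_num) (by norm_num)).const_mul (|β| + 2 * π)
    refine tendsto_iff_dist_tendsto_zero.2
      (squeeze_zero (fun _ => dist_nonneg) (fun k => ?_) h5)
    have hπ := pi_pos
    have h1 : (j k : ℝ) * (2 * π) ≤ 5 ^ k * θ := by
      rw [← le_div_iff₀ (by positivity)]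
      exact Int.floor_le _
    have h2 : 5 ^ k * θ < (j k + 1) * (2 * π) := by
      rw [← div_lt_iff₀ (by positivity)]
      exact Int.lt_floor_add_one _
    have h3 : (β + j k * (2 * π)) / 5 ^ k - θ = (β + j k * (2 * π) - 5 ^ k * θ) * (1 / 5) ^ k := by
      rw [one_div, inv_pow]
      field_simp
    rw [Real.dist_eq, h3, abs_mul, abs_of_pos (a := (1 / 5 : ℝ) ^ k) (by positivity)]
    gcongr
    rw [abs_le]
    constructor <;> linarith [neg_abs_le β, le_abs_self β]

end ClosedSineCurve

/-! ### Consequences of a retraction onto the closed sine curve -/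

section Retraction

variable {X : Type*} [TopologicalSpace X] {r : X → closedSineCurve}

/-- If the closed sine curve is a retract of `X` such that nothing but `b` is attached to its
convergence continuum, then the preimage of that continuum is an `α`-limit set. -/
theorem preimage_convergenceContinuum_mem_alphaLimitSets {i : closedSineCurve → X}
    {b : closedSineCurve} (hr : Continuous r) (hi : Continuous i) (hri : ∀ p, r (i p) = p)
    (hb : b = topPoint ∨ b = bottomPoint)
    (hX : ∀ x, r x ∈ convergenceContinuum → r x = b ∨ i (r x) = x) :
    r ⁻¹' convergenceContinuum ∈ alphaLimitSets X := by
  have hbm : b ∈ convergenceContinuum := by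
    rcases hb with rfl | rfl
    exacts [topPoint_mem, bottomPoint_mem]
  set f : X → X := i ∘ quintuple ∘ r with hf
  have hiter : ∀ k x, f^[k + 1] x = i (quintuple^[k + 1] (r x)) := by
    intro k x
    induction k with
    | zero => rfl
    | succ k ih =>
      rw [Function.iterate_succ_apply', ih, Function.iterate_succ_apply' quintuple (k + 1)]
      simp only [hf, Function.comp_apply, hri]
  refine ⟨f, i b, hi.comp (continuous_quintuple.comp hr), Subset.antisymm (fun x hx => ?_)
    fun x hx => ?_⟩
  · refine mem_iInter.2 fun n => ?_
    -- Points over `b` hit `i b` under every positive iterate; points of the limit arc are only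
    -- limits of preimages.
    rcases hX x hx with h | h
    · refine subset_closure (mem_iUnion₂.2 ⟨n + 1, n.le_succ, ?_⟩)
      rw [mem_preimage, hiter, h, Function.iterate_fixed (quintuple_eq_self hb)]
      rfl
    · obtain ⟨u, hu, hlim⟩ := exists_tendsto_preimages hx hbm
      have hlim' := (hi.tendsto _).comp hlim
      rw [h] at hlim'
      refine mem_closure_of_tendsto hlim' ?_
      filter_upwards [eventually_ge_atTop (n + 1)] with k hk
      refine mem_iUnion₂.2 ⟨k, by omega, ?_⟩
      obtain ⟨m, rfl⟩ : ∃ m, k = m + 1 := ⟨k - 1, by omega⟩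
      rw [mem_preimage, hiter, Function.comp_apply, hri, hu]
      rfl
  · refine closure_minimal (iUnion₂_subset fun k hk z hz => ?_)
      (isClosed_convergenceContinuum.preimage hr) (mem_iInter.1 hx 1)
    obtain ⟨m, rfl⟩ := Nat.exists_eq_add_of_le' hk
    have h1 : i (quintuple^[m + 1] (r z)) = i b := by rw [← hiter]; exact hz
    have h2 : quintuple^[m + 1] (r z) = b := by rw [← hri (quintuple^[m + 1] (r z)), h1, hri]
    rw [mem_preimage, ← quintuple_iterate_mem_iff (m + 1), h2]
    exact hbm

theorem not_hasEnoughArcs_of_map (hr : Continuous r) (hsurj : Function.Surjective r) :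
    ¬ HasEnoughArcs X := by
  rintro ⟨-, h⟩
  obtain ⟨x, hx⟩ := hsurj topPoint
  obtain ⟨y, hy⟩ := hsurj endPoint
  obtain ⟨γ, hγ, h0, h1⟩ := h (r ⁻¹' convergenceContinuum)
    (isClosed_convergenceContinuum.preimage hr)
    ⟨x, by rw [mem_preimage, hx]; exact topPoint_mem⟩
    (ne_univ_iff_exists_notMem _ |>.2 ⟨y, by rw [mem_preimage, hy]; exact endPoint_notMem⟩)
  refine h1 (mem_convergenceContinuum_of_joined ?_ h0)
  exact Joined.map ⟨⟨⟨γ, hγ.continuous⟩, rfl, rfl⟩⟩ hr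

end Retraction

/-! ### The extended sine curve -/

section ExtendedSineCurve

/-- The retraction of the extended sine curve onto the closed sine curve. -/
noncomputable def extendedRetraction (p : extendedSineCurve) : closedSineCurve :=
  ⟨(max p.1.1 0, p.1.2), by
    obtain ⟨⟨x, y⟩, hp | ⟨-, h2, h3⟩⟩ := p
    · dsimp only
      rwa [max_eq_left (closedSineCurve_subset hp).1]
    · dsimp only at h2 h3 ⊢
      rw [max_eq_right h2, h3]
      exact bottomPoint.2⟩

theorem continuous_extendedRetraction : Continuous extendedRetraction := by
  unfold extendedRetraction
  fun_prop

/-- The inclusion of the closed sine curve in the extended one. -/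
def toExtended (p : closedSineCurve) : extendedSineCurve := ⟨p.1, Or.inl p.2⟩

theorem continuous_toExtended : Continuous toExtended := by
  unfold toExtended
  fun_prop

theorem extendedRetraction_toExtended (p : closedSineCurve) :
    extendedRetraction (toExtended p) = p :=
  Subtype.ext (Prod.ext (max_eq_left (closedSineCurve_subset p.2).1) rfl)

theorem toExtended_or_segment (x : extendedSineCurve) :
    (∃ p, x = toExtended p) ∨ (x.1.1 ∈ Icc (-1 : ℝ) 0 ∧ x.1.2 = -1) := by
  rcases x.2 with h | ⟨h1, h2, h3⟩
  · exact Or.inl ⟨⟨x.1, h⟩, rfl⟩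
  · exact Or.inr ⟨⟨h1, h2⟩, h3⟩

theorem joined_bottomPoint_of_segment {x : extendedSineCurve}
    (hx : x.1.1 ∈ Icc (-1 : ℝ) 0) (hy : x.1.2 = -1) : Joined x (toExtended bottomPoint) := by
  let g : Icc (-1 : ℝ) 0 → extendedSineCurve := fun t => ⟨(t, -1), Or.inr ⟨t.2.1, t.2.2, rfl⟩⟩
  have hg : Continuous g :=
    Continuous.subtype_mk (continuous_subtype_val.prodMk continuous_const) _
  have hpc : PathConnectedSpace (Icc (-1 : ℝ) 0) :=
    isPathConnected_iff_pathConnectedSpace.1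
      ((convex_Icc _ _).isPathConnected ⟨0, by norm_num, le_rfl⟩)
  have h := (hpc.joined ⟨x.1.1, hx⟩ ⟨0, by norm_num, le_rfl⟩).map hg
  convert h using 1
  · exact Subtype.ext (Prod.ext rfl hy)
  · rfl

theorem hasAFProperty_extendedSineCurve : HasAFProperty extendedSineCurve := by
  have hnt : Nontrivial extendedSineCurve :=
    ⟨toExtended topPoint, toExtended endPoint, fun h => endPoint_notMem <| by
      rw [← extendedRetraction_toExtended endPoint, ← h, extendedRetraction_toExtended]
      exact topPoint_mem⟩
  refine hasAFProperty_of_forall fun A hA hne hu => ?_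
  by_contra hnot
  have hj : ∀ {x y}, Joined x y → x ∈ A → y ∈ A := fun h hx => by
    by_contra hy
    exact hnot (mem_alphaLimitSets_of_joined hA hx hy h)
  -- all points over the convergence continuum are joined to the bottom point
  have hT : ∀ x, extendedRetraction x ∈ convergenceContinuum →
      Joined x (toExtended bottomPoint) := by
    intro x hx
    rcases toExtended_or_segment x with ⟨p, rfl⟩ | ⟨h1, h2⟩
    · rw [extendedRetraction_toExtended] at hx
      exact (joined_of_mem_convergenceContinuum hx bottomPoint_mem).map continuous_toExtended
    · exact joined_bottomPoint_of_segment h1 h2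
  have hS : ∀ x, extendedRetraction x ∉ convergenceContinuum →
      Joined x (toExtended endPoint) := by
    intro x hx
    rcases toExtended_or_segment x with ⟨p, rfl⟩ | ⟨h1, h2⟩
    · rw [extendedRetraction_toExtended] at hx
      exact (joined_endPoint hx).map continuous_toExtended
    · exact absurd (max_eq_right h1.2) hx
  have hbot : extendedRetraction (toExtended bottomPoint) ∈ convergenceContinuum := by
    rw [extendedRetraction_toExtended]
    exact bottomPoint_mem
  have hend : toExtended endPoint ∉ A := by
    -- The path component of the endpoint is dense in the closed sine curve, so a closed union of
    -- components containing it is the whole space.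
    intro he
    have h1 : ∀ p, toExtended p ∈ A := by
      intro p
      refine (hA.preimage continuous_toExtended).closure_subset_iff.2 ?_
        (dense_compl_convergenceContinuum p)
      exact fun q hq => hj ((joined_endPoint hq).map continuous_toExtended).symm he
    refine hu (eq_univ_of_forall fun x => ?_)
    by_cases hx : extendedRetraction x ∈ convergenceContinuum
    · exact hj (hT x hx).symm (h1 _)
    · exact hj (hS x hx).symm he
  have hA' : A = extendedRetraction ⁻¹' convergenceContinuum := by
    have h1 : A ⊆ extendedRetraction ⁻¹' convergenceContinuum := fun x hx => by
      by_contra h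
      exact hend (hj (hS x h) hx)
    obtain ⟨z, hz⟩ := hne
    exact Subset.antisymm h1 fun x hx => hj ((hT z (h1 hz)).trans (hT x hx).symm) hz
  refine hnot (hA' ▸ preimage_convergenceContinuum_mem_alphaLimitSets
    continuous_extendedRetraction continuous_toExtended extendedRetraction_toExtended
    (Or.inr rfl) fun x hx => ?_)
  rcases toExtended_or_segment x with ⟨p, rfl⟩ | ⟨h1, h2⟩
  · exact Or.inr (by rw [extendedRetraction_toExtended])
  · exact Or.inl (Subtype.ext (Prod.ext (max_eq_right h1.2) h2))

theorem not_hasEnoughArcs_extendedSineCurve : ¬ HasEnoughArcs extendedSineCurve :=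
  not_hasEnoughArcs_of_map continuous_extendedRetraction fun p =>
    ⟨_, extendedRetraction_toExtended p⟩

end ExtendedSineCurve

/-! ### Chains of sine curves -/

namespace ChainOfSineCurves

variable {Y : Type*} [TopologicalSpace Y] (c : ChainOfSineCurves Y)

theorem eq_s_or_mem_range (y : Y) : y = c.s ∨ ∃ i, y ∈ range (c.curve i) := by
  have h : y ∈ (⋃ i, range (c.curve i)) ∪ {c.s} := by rw [c.union_eq]; trivial
  rcases h with h | h
  · exact Or.inr (mem_iUnion.1 h)
  · exact Or.inl h

theorem exists_bPoint (n : ℕ) :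
    ∃ p : closedSineCurve, (p = topPoint ∨ p = bottomPoint) ∧ c.curve n p = c.b n := by
  rcases c.b_eq n with h | h
  exacts [⟨_, Or.inl rfl, h.symm⟩, ⟨_, Or.inr rfl, h.symm⟩]

/-- The union of the first `n` curves. -/
def head (n : ℕ) : Set Y := ⋃ i < n, range (c.curve i)

/-- The union of `s` and of all curves past the `n`-th. -/
def tail (n : ℕ) : Set Y := (⋃ i > n, range (c.curve i)) ∪ {c.s}

theorem isClosed_range [T2Space Y] (i : ℕ) : IsClosed (range (c.curve i)) := by
  have : CompactSpace closedSineCurve := by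
    refine isCompact_iff_compactSpace.1 (Metric.isCompact_of_isClosed_isBounded isClosed_closure ?_)
    refine (Metric.isBounded_Icc ((0 : ℝ), (-1 : ℝ)) (2 / Real.pi, 1)).subset fun p hp => ?_
    obtain ⟨h1, h2, h3, h4, -⟩ := closedSineCurve_subset hp
    exact ⟨⟨h1, h3⟩, ⟨h2, h4⟩⟩
  exact (isCompact_range (c.isEmbedding_curve i).continuous).isClosed

theorem isClosed_head [T2Space Y] (n : ℕ) : IsClosed (c.head n) :=
  (finite_lt_nat n).isClosed_biUnion fun i _ => c.isClosed_range i

/-- Away from `s` only finitely many of the curves matter locally. -/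
theorem isClosed_tail [T2Space Y] (n : ℕ) : IsClosed (c.tail n) := by
  refine isClosed_of_closure_subset fun y hy => ?_
  by_cases hys : y = c.s
  · exact Or.inr hys
  obtain ⟨U, V, hU, hV, hsU, hyV, hUV⟩ := t2_separation (Ne.symm hys)
  obtain ⟨N, hN⟩ := eventually_atTop.1 (c.converges U (hU.mem_nhds hsU))
  have hfin : IsClosed (⋃ i ∈ Ioo n N, range (c.curve i)) :=
    (finite_Ioo n N).isClosed_biUnion fun i _ => c.isClosed_range i
  have hsub : c.tail n ⊆ Vᶜ ∪ ⋃ i ∈ Ioo n N, range (c.curve i) := by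
    rintro z (hz | rfl)
    · obtain ⟨i, hi, hz⟩ := mem_iUnion₂.1 hz
      rcases lt_or_ge i N with h | h
      · exact Or.inr (mem_iUnion₂.2 ⟨i, ⟨hi, h⟩, hz⟩)
      · exact Or.inl (disjoint_left.1 hUV (hN i h hz))
    · exact Or.inl (disjoint_left.1 hUV hsU)
  rcases closure_minimal hsub (hV.isClosed_compl.union hfin) hy with h | h
  · exact absurd hyV h
  · obtain ⟨i, hi, h⟩ := mem_iUnion₂.1 h
    exact Or.inl (mem_iUnion₂.2 ⟨i, hi.1, h⟩)

/-- With `eq_b_of_mem_tail`, this makes the pieces of the retraction agree on overlaps. -/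
theorem eq_endPoint_of_mem_head {n : ℕ} {p : closedSineCurve} (h : c.curve n p ∈ c.head n) :
    p = endPoint := by
  obtain ⟨i, hi, h⟩ := mem_iUnion₂.1 h
  obtain rfl | hlt : n = i + 1 ∨ i + 1 < n := by omega
  · have h2 : c.curve (i + 1) p ∈ ({c.b i} : Set Y) := by
      rw [← c.inter_succ]
      exact ⟨h, p, rfl⟩
    refine (c.isEmbedding_curve (i + 1)).injective ?_
    rw [← c.b_eq_endPoint]
    exact h2
  · exact absurd ⟨p, rfl⟩ (disjoint_left.1 (c.disjoint_of_lt i n hlt) h)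

theorem eq_b_of_mem_tail {n : ℕ} {p : closedSineCurve} (h : c.curve n p ∈ c.tail n) :
    c.curve n p = c.b n := by
  rcases h with h | h
  · obtain ⟨i, hi, h⟩ := mem_iUnion₂.1 h
    obtain rfl | hlt : i = n + 1 ∨ n + 1 < i := by
      have : n < i := hi
      omega
    · have h2 : c.curve n p ∈ ({c.b n} : Set Y) := by
        rw [← c.inter_succ]
        exact ⟨⟨p, rfl⟩, h⟩
      exact h2
    · exact absurd h (disjoint_left.1 (c.disjoint_of_lt n i hlt) ⟨p, rfl⟩)
  · exact absurd ⟨p, h⟩ (c.s_notMem n)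

theorem disjoint_head_tail (n : ℕ) : Disjoint (c.head n) (c.tail n) := by
  refine disjoint_left.2 fun y hh ht => ?_
  obtain ⟨i, hi, hh⟩ := mem_iUnion₂.1 hh
  rcases ht with ht | rfl
  · obtain ⟨j, hj, ht⟩ := mem_iUnion₂.1 ht
    have hj : n < j := hj
    exact disjoint_left.1 (c.disjoint_of_lt i j (by omega)) hh ht
  · exact c.s_notMem i hh

theorem head_union_range_union_tail (n : ℕ) :
    c.head n ∪ range (c.curve n) ∪ c.tail n = univ := by
  refine eq_univ_of_forall fun y => ?_
  rcases c.eq_s_or_mem_range y with rfl | ⟨i, hi⟩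
  · exact Or.inr (Or.inr rfl)
  · rcases lt_trichotomy i n with h | rfl | h
    · exact Or.inl (Or.inl (mem_iUnion₂.2 ⟨i, h, hi⟩))
    · exact Or.inl (Or.inr hi)
    · exact Or.inr (Or.inl (mem_iUnion₂.2 ⟨i, h, hi⟩))

/-- There is a retraction onto the `n`-th curve that collapses the earlier curves to its endpoint
and the later ones to `b n`. -/
theorem exists_retraction [T2Space Y] (n : ℕ) :
    ∃ r : Y → closedSineCurve, Continuous r ∧ (∀ p, r (c.curve n p) = p) ∧
      (∀ y ∈ c.head n, r y = endPoint) ∧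
      ∀ y ∈ c.tail n, c.curve n (r y) = c.b n := by
  classical
  obtain ⟨q, -, hq⟩ := c.exists_bPoint n
  have hinj := (c.isEmbedding_curve n).injective
  let r : Y → closedSineCurve := fun y =>
    if h : y ∈ range (c.curve n) then h.choose else if y ∈ c.head n then endPoint else q
  have hr : ∀ p, r (c.curve n p) = p := fun p => by
    have h : c.curve n p ∈ range (c.curve n) := ⟨p, rfl⟩
    simp only [r, dif_pos h]
    exact hinj h.choose_spec
  have hhead : ∀ y ∈ c.head n, r y = endPoint := by
    intro y hy
    by_cases h : y ∈ range (c.curve n)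
    · obtain ⟨p, rfl⟩ := h
      rw [hr]
      exact c.eq_endPoint_of_mem_head hy
    · simp only [r, dif_neg h, if_pos hy]
  have htail : ∀ y ∈ c.tail n, r y = q := by
    intro y hy
    by_cases h : y ∈ range (c.curve n)
    · obtain ⟨p, rfl⟩ := h
      rw [hr]
      exact hinj ((c.eq_b_of_mem_tail hy).trans hq.symm)
    · simp only [r, dif_neg h, if_neg (disjoint_right.1 (c.disjoint_head_tail n) hy)]
  refine ⟨r, ?_, hr, hhead, fun y hy => by rw [htail y hy, hq]⟩
  have hmid : ContinuousOn r (range (c.curve n)) := by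
    rw [continuousOn_iff_continuous_domRestrict]
    have heq : (range (c.curve n)).domRestrict r
        = (c.isEmbedding_curve n).toHomeomorph.symm := by
      ext1 y
      obtain ⟨p, rfl⟩ := (c.isEmbedding_curve n).toHomeomorph.surjective y
      rw [Homeomorph.symm_apply_apply]
      exact hr p
    rw [heq]
    exact Homeomorph.continuous _
  have h1 : ContinuousOn r (c.head n) := continuousOn_const.congr hhead
  have h3 : ContinuousOn r (c.tail n) := continuousOn_const.congr htail
  rw [← continuousOn_univ, ← c.head_union_range_union_tail n]
  exact (h1.union_of_isClosed hmid (c.isClosed_head n) (c.isClosed_range n)).union_of_isClosed h3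
    ((c.isClosed_head n).union (c.isClosed_range n)) (c.isClosed_tail n)

theorem not_hasEnoughArcs {Y : Type*} [TopologicalSpace Y] [T2Space Y]
    (c : ChainOfSineCurves Y) : ¬ HasEnoughArcs Y := by
  obtain ⟨r, hr, hrc, -⟩ := c.exists_retraction 0
  exact not_hasEnoughArcs_of_map hr fun p => ⟨_, hrc p⟩

/-- A closed union of path components that meets one curve contains all later curves and `s`. It is
thus determined by the first curve it meets, of which it contains exactly the limit arc. -/
theorem hasAFProperty {Y : Type*} [TopologicalSpace Y] [TopologicalSpace.MetrizableSpace Y]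
    (c : ChainOfSineCurves Y) : HasAFProperty Y := by
  have hnt : Nontrivial Y := ⟨c.s, c.curve 0 topPoint, fun h => c.s_notMem 0 ⟨_, h.symm⟩⟩
  refine hasAFProperty_of_forall fun A hA hne hu => ?_
  by_contra hnot
  have hj : ∀ {x y}, Joined x y → x ∈ A → y ∈ A := fun h hx => by
    by_contra hy
    exact hnot (mem_alphaLimitSets_of_joined hA hx hy h)
  have hcont := fun i => (c.isEmbedding_curve i).continuous
  -- a curve whose open part meets `A` lies in `A`
  have hS : ∀ {i p}, p ∉ convergenceContinuum → c.curve i p ∈ A → range (c.curve i) ⊆ A := by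
    intro i p hp hpA
    rintro _ ⟨q, rfl⟩
    refine (hA.preimage (hcont i)).closure_subset_iff.2 ?_ (dense_compl_convergenceContinuum q)
    exact fun q hq => hj (((joined_endPoint hp).trans (joined_endPoint hq).symm).map (hcont i)) hpA
  have hB : ∀ {i p q}, p ∈ convergenceContinuum → q ∈ convergenceContinuum →
      c.curve i p ∈ A → c.curve i q ∈ A := fun hp hq h =>
    hj ((joined_of_mem_convergenceContinuum hp hq).map (hcont _)) h
  have hb : ∀ {i p}, c.curve i p ∈ A → c.b i ∈ A := by
    intro i p hp
    obtain ⟨q, hq, hqb⟩ := c.exists_bPoint i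
    have hqm : q ∈ convergenceContinuum := by
      rcases hq with rfl | rfl
      exacts [topPoint_mem, bottomPoint_mem]
    rw [← hqb]
    by_cases h : p ∈ convergenceContinuum
    · exact hB h hqm hp
    · exact hS h hp ⟨q, rfl⟩
  have hnext : ∀ {i p}, c.curve i p ∈ A → range (c.curve (i + 1)) ⊆ A := fun hp => by
    have h := hb hp
    rw [c.b_eq_endPoint] at h
    exact hS endPoint_notMem h
  have htail : ∀ {i p}, c.curve i p ∈ A → c.tail i ⊆ A := by
    intro i p hp
    have hgt : ∀ j, range (c.curve (i + 1 + j)) ⊆ A := by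
      intro j
      induction j with
      | zero => exact hnext hp
      | succ j ih => exact hnext (ih ⟨topPoint, rfl⟩)
    rintro y (hy | rfl)
    · obtain ⟨j, hij, hy⟩ := mem_iUnion₂.1 hy
      obtain ⟨k, rfl⟩ := Nat.exists_eq_add_of_le (Nat.succ_le_of_lt hij)
      exact hgt k hy
    · rw [← hA.closure_eq]
      refine mem_closure_iff_nhds.2 fun U hU => ?_
      obtain ⟨N, hN⟩ := eventually_atTop.1 (c.converges U hU)
      exact ⟨c.curve (i + 1 + N) topPoint, hN (i + 1 + N) (by omega) ⟨_, rfl⟩, hgt N ⟨_, rfl⟩⟩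
  by_cases hex : ∃ i p, c.curve i p ∈ A
  · classical
    have hmin := fun m hm => Nat.find_min hex (m := m) hm
    obtain ⟨p, hp⟩ := Nat.find_spec hex
    generalize Nat.find hex = n at hmin hp
    -- Otherwise `A` contains the endpoint of the `n`-th curve, which lies on the previous curve,
    -- against minimality; for `n = 0` it would be the whole space.
    have hSn : ∀ q, q ∉ convergenceContinuum → c.curve n q ∉ A := by
      intro q hq hqA
      have hrange := hS hq hqA
      cases n with
      | zero =>
        refine hu (eq_univ_of_forall fun y => ?_)
        have hy : y ∈ c.head 0 ∪ range (c.curve 0) ∪ c.tail 0 := by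
          rw [c.head_union_range_union_tail]
          trivial
        rcases hy with (hy | hy) | hy
        · simp [head] at hy
        · exact hrange hy
        · exact htail hp hy
      | succ m =>
        obtain ⟨z, -, hz⟩ := c.exists_bPoint m
        refine hmin m m.lt_succ_self ⟨z, ?_⟩
        rw [hz, c.b_eq_endPoint]
        exact hrange ⟨_, rfl⟩
    have hpm : p ∈ convergenceContinuum := by
      by_contra h
      exact hSn p h hp
    obtain ⟨r, hr, hrc, hrh, hrt⟩ := c.exists_retraction n
    obtain ⟨q, hq, hqb⟩ := c.exists_bPoint n
    have hqm : q ∈ convergenceContinuum := by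
      rcases hq with rfl | rfl
      exacts [topPoint_mem, bottomPoint_mem]
    have hrt' : ∀ y ∈ c.tail n, r y = q := fun y hy =>
      (c.isEmbedding_curve n).injective ((hrt y hy).trans hqb.symm)
    have hcases : ∀ y, y ∈ c.head n ∪ range (c.curve n) ∪ c.tail n := fun y => by
      rw [c.head_union_range_union_tail]
      trivial
    have hAr : A = r ⁻¹' convergenceContinuum := by
      ext y
      rw [mem_preimage]
      rcases hcases y with (hy | ⟨z, rfl⟩) | hy
      · refine iff_of_false (fun hyA => ?_) (by rw [hrh y hy]; exact endPoint_notMem)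
        obtain ⟨i, hi, z, rfl⟩ := mem_iUnion₂.1 hy
        exact hmin i hi ⟨z, hyA⟩
      · rw [hrc]
        exact ⟨fun h => by_contra fun hz => hSn z hz h, fun hz => hB hpm hz hp⟩
      · rw [hrt' y hy]
        exact iff_of_true (htail hp hy) hqm
    refine hnot (hAr ▸ preimage_convergenceContinuum_mem_alphaLimitSets hr (hcont n) hrc hq
      fun y hy => ?_)
    rcases hcases y with (h | ⟨z, rfl⟩) | h
    · rw [hrh y h] at hy
      exact absurd hy endPoint_notMem
    · exact Or.inr (by rw [hrc])
    · exact Or.inl (hrt' y h)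
  · have hAs : A = {c.s} := by
      refine hne.subset_singleton_iff.1 fun y hy => ?_
      rcases c.eq_s_or_mem_range y with rfl | ⟨i, p, rfl⟩
      · rfl
      · exact absurd ⟨i, p, hy⟩ hex
    exact hnot (hAs ▸ singleton_mem_alphaLimitSets c.s)

end ChainOfSineCurves

end AFSpaces

theorem lemma2p13 :
    (AFSpaces.HasAFProperty AFSpaces.extendedSineCurve ∧
      ¬ AFSpaces.HasEnoughArcs AFSpaces.extendedSineCurve) ∧
    ∀ (Y : Type*) [TopologicalSpace Y] [TopologicalSpace.MetrizableSpace Y],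
      AFSpaces.ChainOfSineCurves Y →
        AFSpaces.HasAFProperty Y ∧ ¬ AFSpaces.HasEnoughArcs Y :=
  ⟨⟨AFSpaces.hasAFProperty_extendedSineCurve, AFSpaces.not_hasEnoughArcs_extendedSineCurve⟩,
    fun _ _ _ c => ⟨c.hasAFProperty, c.not_hasEnoughArcs⟩⟩
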